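/- Let $p\ge q\ge 1$ and $m,s\ge 0$ be integers, let $X=\mathbf{R}^{p\times q}$ with the Frobenius inner product, and let $A,H:X\to\mathbf{R}^m$ be linear maps; $H^*:\mathbf{R}^m\to X$ denotes the conjugate of $H$ and $\mathrm{Id}$ the identity map of $X$. Let $\|\cdot\|$ be the nuclear norm (the sum of the singular values) and $\|\cdot\|_{2,2}$ the spectral norm (the largest singular value). For a linear map $W:X\to X$ let $\Theta[W]\in\mathbf{R}^{pq\times pq}$ be the matrix such that $$\mathrm{Tr}\big((Wz)h^T\big)=\sum_{i,j=1}^{pq}(\Theta[W])_{ij}\,(h^T\otimes z)_{ij}\qquad\text{for all } h,z\in X,$$ where $\otimes$ is the Kronecker product. For real $k\ge 0$ let $\mathbf{U}_k=\{\mathcal{U}\in\mathbf{R}^{pq\times pq}:\|\mathcal{U}\|\le k,\ \|\mathcal{U}\|_{2,2}\le 1\}$, and set $$\overline{\mathrm{Opt}}[W]=\max_{\mathcal{U},\mathcal{V}}\Big\{\sum_{i,j=1}^{pq}(\Theta[W])_{ij}\,[\mathcal{U}_{ij}+\mathcal{V}_{ij}]:\ \mathcal{U}\in\mathbf{U}_s,\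 \mathcal{V}\in\mathbf{U}_{2s}\Big\}.$$ Then, for all such $p,q,m,s,A,H$, $$\overline{\mathrm{Opt}}[\mathrm{Id}-H^*A]\ \ge\ \min\left[2s\sqrt{\frac{\dim\operatorname{Ker}A}{pq}},\ \sqrt{\dim\operatorname{Ker}A}\right].$$ Say that the verifiable condition certifies $s$-goodness of $A$ if there are a linear map $H:X\to\mathbf{R}^m$ and a real $\gamma<1$ with $\overline{\mathrm{Opt}}[\mathrm{Id}-H^*A]\le\gamma$. Then for every $c>0$ there is a constant $C$, depending only on $c$, such that for all integers $p\ge q\ge1$, $m,s\ge0$ and every linear map $A:X\to\mathbf{R}^m$ with $\dim\operatorname{Ker}A\ge c\,pq$: if the verifiable condition certifies $s$-goodness of $A$, then $s\le C$. -/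

import Mathlib

open scoped Matrix Kronecker

noncomputable section

namespace NuclearRecovery

section Norms

variable {m n : Type*} [Fintype m] [Fintype n] [DecidableEq n]

/-- The singular values `σ₁ ≥ σ₂ ≥ …` of a real matrix, indexed from `0`
(they vanish from index `card n` on). -/
def sigma (M : Matrix m n ℝ) (i : ℕ) : ℝ :=
  (Matrix.toEuclideanLin M).singularValues i

/-- The nuclear norm: the sum of all singular values. -/
def nuclearNorm (M : Matrix m n ℝ) : ℝ :=
  ∑ i ∈ Finset.range (Fintype.card n), sigma M i

/-- The spectral norm: the largest singular value. -/
def spectralNorm (M : Matrix m n ℝ) : ℝ := sigma M 0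

theorem spectralNorm_le_one_iff (M : Matrix m n ℝ) :
    spectralNorm M ≤ 1 ↔ ∀ x, ‖Matrix.toEuclideanLin M x‖ ≤ ‖x‖ := by
  set T := Matrix.toEuclideanLin M with hT
  have hS := T.isSymmetric_adjoint_comp_self
  let b := hS.eigenvectorBasis rfl
  have key (x : EuclideanSpace ℝ n) :
      ‖T x‖ ^ 2 = ∑ i : Fin (Module.finrank ℝ (EuclideanSpace ℝ n)),
        (T.singularValues i) ^ 2 * inner ℝ (b i) x ^ 2 := by
    rw [← real_inner_self_eq_norm_sq, ← LinearMap.adjoint_inner_right, ← LinearMap.comp_apply,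
      ← b.sum_inner_mul_inner]
    refine Finset.sum_congr rfl fun i _ => ?_
    have := hS.eigenvectorBasis_apply_self_apply rfl x i
    rw [OrthonormalBasis.repr_apply_apply, OrthonormalBasis.repr_apply_apply] at this
    rw [this, T.sq_singularValues_fin rfl i, real_inner_comm]
    simp only [b, RCLike.ofReal_real_eq_id, id]
    ring
  constructor
  · intro h x
    refine le_of_sq_le_sq ?_ (norm_nonneg _)
    rw [key, ← b.sum_sq_norm_inner_right x]
    refine Finset.sum_le_sum fun i _ => ?_
    have h1 : T.singularValues i ≤ 1 := (T.singularValues_antitone (Nat.zero_le _)).trans h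
    have h2 : T.singularValues i ^ 2 ≤ 1 := pow_le_one₀ (T.singularValues_nonneg i) h1
    rw [Real.norm_eq_abs, sq_abs]
    exact mul_le_of_le_one_left (sq_nonneg _) h2
  · intro h
    show T.singularValues 0 ≤ 1
    by_cases h0 : Module.finrank ℝ (EuclideanSpace ℝ n) = 0
    · rw [T.singularValues_of_finrank_le h0.le]; exact zero_le_one
    let i0 : Fin (Module.finrank ℝ (EuclideanSpace ℝ n)) := ⟨0, Nat.pos_of_ne_zero h0⟩
    have h1 := key (b i0)
    rw [Finset.sum_eq_single i0] at h1
    · have h2 := h (b i0)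
      rw [real_inner_self_eq_norm_sq] at h1
      rw [b.norm_eq_one] at h1 h2
      have : T.singularValues (i0 : ℕ) ^ 2 ≤ 1 := by
        have : ‖T (b i0)‖ ^ 2 ≤ 1 := pow_le_one₀ (norm_nonneg _) h2
        nlinarith
      exact (sq_le_one_iff₀ (T.singularValues_nonneg _)).1 this
    · intro j _ hj
      rw [b.orthonormal.2 hj]; simp
    · simp

theorem isClosed_spectralNorm_le_one : IsClosed {M : Matrix m n ℝ | spectralNorm M ≤ 1} := by
  simp only [spectralNorm_le_one_iff, Set.ofPred_forall]
  refine isClosed_iInter fun x => isClosed_le ?_ continuous_const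
  simp only [Matrix.toLpLin_apply]
  fun_prop

theorem abs_entry_le_one [DecidableEq m] (M : Matrix m n ℝ) (h : spectralNorm M ≤ 1) (i : m) (j : n) :
    |M i j| ≤ 1 := by
  have h1 := (spectralNorm_le_one_iff M).1 h (EuclideanSpace.single j 1)
  have h2 := PiLp.norm_apply_le (Matrix.toEuclideanLin M (EuclideanSpace.single j 1)) i
  simp [Matrix.toLpLin_apply] at h1 h2
  exact h2.trans h1

theorem adjoint_comp_self_eq [DecidableEq m] (M : Matrix m n ℝ) :
    LinearMap.adjoint (Matrix.toEuclideanLin M) ∘ₗ Matrix.toEuclideanLin M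
      = Matrix.toEuclideanLin (Mᴴ * M) := by
  rw [← Matrix.toEuclideanLin_conjTranspose_eq_adjoint]
  refine LinearMap.ext fun x => ?_
  rw [LinearMap.comp_apply]
  simp only [Matrix.toLpLin_apply, Matrix.mulVec_mulVec]

theorem eigenvalues_congr {S S' : EuclideanSpace ℝ n →ₗ[ℝ] EuclideanSpace ℝ n} (hS : S.IsSymmetric)
    (hS' : S'.IsSymmetric) (h : S = S') (i : Fin (Fintype.card n)) :
    hS.eigenvalues finrank_euclideanSpace i = hS'.eigenvalues finrank_euclideanSpace i := by
  subst h; rfl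

theorem sigma_eq_sqrt_eigenvalues [DecidableEq m] (M : Matrix m n ℝ) (hA : (Mᴴ * M).IsHermitian)
    (i : Fin (Fintype.card n)) : sigma M i = √(hA.eigenvalues₀ i) :=
  (LinearMap.singularValues_fin _ finrank_euclideanSpace i).trans
    (congrArg Real.sqrt (eigenvalues_congr _ _ (adjoint_comp_self_eq M) i))

open scoped MatrixOrder Matrix.Norms.L2Operator in
theorem trace_sqrt_aux (A : Matrix n n ℝ) (hp : A.PosSemidef) :
    (CFC.sqrt A).trace = ∑ i, √(hp.isHermitian.eigenvalues₀ i) := by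
  have hA := hp.isHermitian
  have h1 : CFC.sqrt A = hA.cfc Real.sqrt := by
    rw [CFC.sqrt_eq_real_sqrt _ (Matrix.nonneg_iff_posSemidef.2 hp), cfcₙ_eq_cfc, hA.cfc_eq]
  have h2 : (hA.cfc Real.sqrt).trace = ∑ i, √(hA.eigenvalues i) := by
    rw [Matrix.IsHermitian.cfc, Unitary.conjStarAlgAut_apply, Matrix.trace_mul_cycle,
      Unitary.coe_star_mul_self, one_mul, Matrix.trace_diagonal]
    rfl
  rw [h1, h2]
  exact Equiv.sum_comp (Fintype.equivOfCardEq (Fintype.card_fin _)).symm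
    (fun i => √(hA.eigenvalues₀ i))

open scoped MatrixOrder Matrix.Norms.L2Operator in
theorem nuclearNorm_eq_trace [DecidableEq m] (M : Matrix m n ℝ) :
    nuclearNorm M = (CFC.sqrt (Mᴴ * M)).trace := by
  rw [trace_sqrt_aux _ (Matrix.posSemidef_conjTranspose_mul_self M), nuclearNorm, Finset.sum_range]
  exact Finset.sum_congr rfl fun i _ => sigma_eq_sqrt_eigenvalues M _ i

open scoped MatrixOrder Matrix.Norms.L2Operator in
theorem continuous_nuclearNorm [DecidableEq m] :
    Continuous (nuclearNorm : Matrix m n ℝ → ℝ) := by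
  rw [funext nuclearNorm_eq_trace]
  have h : Continuous fun M : Matrix m n ℝ => CFC.sqrt (Mᴴ * M) :=
    CFC.continuousOn_sqrt.comp_continuous (by fun_prop)
      fun M => Matrix.nonneg_iff_posSemidef.2 (Matrix.posSemidef_conjTranspose_mul_self M)
  exact h.matrix_trace

end Norms

variable {p q m : ℕ}

/-- The signal space `X = ℝ^{p × q}`. -/
abbrev Sig (p q : ℕ) : Type := Matrix (Fin p) (Fin q) ℝ

/-- The space `ℝ^{pq × pq}`, seen as `q × p` block matrices with `p × q` blocks:
the row index is `(μ, i)` with `μ : Fin q`, `i : Fin p`, the column index is `(ν, j)` with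
`ν : Fin p`, `j : Fin q`, and `(i, j)` is the position within the block `(μ, ν)`.
For `h z : Sig p q` the Kronecker product `hᵀ ⊗ₖ z` is such a matrix. -/
abbrev BigMat (p q : ℕ) : Type := Matrix (Fin q × Fin p) (Fin p × Fin q) ℝ

/-- The conjugate `H^* : ℝ^m → X` of a linear map `H : X → ℝ^m`, with respect to the Frobenius
inner product on `X` and the standard inner product on `ℝ^m`. -/
def conj (H : Sig p q →ₗ[ℝ] (Fin m → ℝ)) : (Fin m → ℝ) →ₗ[ℝ] Sig p q where
  toFun v := Matrix.of fun i j => H (Matrix.single i j 1) ⬝ᵥ v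
  map_add' u v := by ext i j; simp [dotProduct_add]
  map_smul' c v := by ext i j; simp [dotProduct_smul]

/-- A linear function(al) of a matrix expands over the matrix units. -/
theorem sum_single_expand {F : Type*} [AddCommGroup F] [Module ℝ F]
    (L : Sig p q →ₗ[ℝ] F) (z : Sig p q) :
    L z = ∑ i, ∑ j, z i j • L (Matrix.single i j 1) := by
  conv_lhs => rw [Matrix.matrix_eq_sum_single z]
  simp only [map_sum, ← map_smul, Matrix.smul_single, smul_eq_mul, mul_one]

/-- The defining property of the conjugate: `⟨H^* v, z⟩ = ⟨v, H z⟩`. -/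
theorem conj_spec (H : Sig p q →ₗ[ℝ] (Fin m → ℝ)) (v : Fin m → ℝ) (z : Sig p q) :
    ((conj H v) * zᵀ).trace = v ⬝ᵥ H z := by
  rw [sum_single_expand H z]
  simp only [Matrix.trace, Matrix.diag, Matrix.mul_apply, conj, LinearMap.coe_mk, AddHom.coe_mk,
    Matrix.of_apply, Matrix.transpose_apply, dotProduct_sum, dotProduct_smul, smul_eq_mul]
  refine Finset.sum_congr rfl fun i _ => Finset.sum_congr rfl fun j _ => ?_
  rw [dotProduct_comm, mul_comm]

/-- The `pq × pq` matrix `Θ[W]` of a linear map `W : X → X`; its block `(μ, ν)` has the entry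
`(W e_{ij})_{νμ}` in position `(i, j)`, where `e_{ij}` are the matrix units. -/
def Theta (W : Sig p q →ₗ[ℝ] Sig p q) : BigMat p q :=
  Matrix.of fun a b => W (Matrix.single a.2 b.2 1) b.1 a.1

/-- The defining property of `Θ[W]`:
`Tr([W z] hᵀ) = ∑ (Θ[W])_{ab} (hᵀ ⊗ z)_{ab}` for all `z`, `h`. -/
theorem Theta_spec (W : Sig p q →ₗ[ℝ] Sig p q) (z h : Sig p q) :
    ((W z) * hᵀ).trace = ∑ a, ∑ b, Theta W a b * (hᵀ ⊗ₖ z) a b := by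
  rw [sum_single_expand W z]
  simp only [Matrix.trace, Matrix.diag, Matrix.mul_apply, Matrix.transpose_apply, Theta,
    Matrix.of_apply, Matrix.kroneckerMap_apply, Fintype.sum_prod_type, Matrix.sum_apply,
    Matrix.smul_apply, smul_eq_mul, Finset.sum_mul]
  rw [Finset.sum_comm]
  refine Finset.sum_congr rfl fun μ _ => ?_
  rw [Finset.sum_comm]
  refine Finset.sum_congr rfl fun i _ => ?_
  refine Finset.sum_congr rfl fun ν _ => ?_
  refine Finset.sum_congr rfl fun j _ => ?_
  ring

/-- The set `U_k` of `pq × pq` matrices with nuclear norm at most `k` and spectral norm at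
most `1`. -/
def relaxSet (p q : ℕ) (k : ℝ) : Set (BigMat p q) :=
  {U | nuclearNorm U ≤ k ∧ spectralNorm U ≤ 1}

/-- The values of the objective in the relaxed problem: the numbers
`∑ (Θ[W])_{ab} (U_{ab} + V_{ab})` with `U ∈ U_s` and `V ∈ U_{2s}`. -/
def optBarValues (s : ℕ) (W : Sig p q →ₗ[ℝ] Sig p q) : Set ℝ :=
  {t | ∃ U ∈ relaxSet p q (s : ℝ), ∃ V ∈ relaxSet p q (2 * (s : ℝ)),
    t = ∑ a, ∑ b, Theta W a b * (U a b + V a b)}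

/-- The relaxation-based bound `Opt̄[W]`: the maximum of the objective over the relaxed feasible
set. -/
def optBar (s : ℕ) (W : Sig p q →ₗ[ℝ] Sig p q) : ℝ := sSup (optBarValues s W)

theorem isCompact_relaxSet (p q : ℕ) (k : ℝ) : IsCompact (relaxSet p q k) := by
  have hc : IsClosed (relaxSet p q k) :=
    (isClosed_le continuous_nuclearNorm continuous_const).inter isClosed_spectralNorm_le_one
  have hb : relaxSet p q k ⊆ Set.pi Set.univ fun _ => Set.pi Set.univ fun _ => Set.Icc (-1 : ℝ) 1 := by
    intro U hU i _ j _
    exact abs_le.1 (abs_entry_le_one U hU.2 i j)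
  exact (isCompact_univ_pi fun _ => isCompact_univ_pi fun _ => isCompact_Icc).of_isClosed_subset hc hb

theorem zero_mem_relaxSet (p q : ℕ) {k : ℝ} (hk : 0 ≤ k) : (0 : BigMat p q) ∈ relaxSet p q k := by
  simp [relaxSet, nuclearNorm, spectralNorm, sigma, hk]

/-- The supremum in the definition of `optBar` is a maximum. -/
theorem optBar_isGreatest (s : ℕ) (W : Sig p q →ₗ[ℝ] Sig p q) :
    IsGreatest (optBarValues s W) (optBar s W) := by
  have h : optBarValues s W = (fun P : BigMat p q × BigMat p q =>
      ∑ a, ∑ b, Theta W a b * (P.1 a b + P.2 a b)) ''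
        (relaxSet p q (s : ℝ) ×ˢ relaxSet p q (2 * (s : ℝ))) := by
    ext t
    simp only [optBarValues, Set.mem_ofPred_eq, Set.mem_image, Set.mem_prod, Prod.exists]
    constructor
    · rintro ⟨U, hU, V, hV, rfl⟩; exact ⟨U, V, ⟨hU, hV⟩, rfl⟩
    · rintro ⟨U, V, ⟨hU, hV⟩, rfl⟩; exact ⟨U, hU, V, hV, rfl⟩
  have hcomp : IsCompact (optBarValues s W) := by
    rw [h]
    refine ((isCompact_relaxSet p q _).prod (isCompact_relaxSet p q _)).image ?_
    refine continuous_finsetSum _ fun a _ => continuous_finsetSum _ fun b _ => ?_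
    exact continuous_const.mul ((continuous_fst.matrix_elem a b).add (continuous_snd.matrix_elem a b))
  refine hcomp.isGreatest_sSup ?_
  exact ⟨_, 0, zero_mem_relaxSet p q (by positivity), 0, zero_mem_relaxSet p q (by positivity), rfl⟩

/-- The map `Id - H^* A : X → X`. -/
def residual (A H : Sig p q →ₗ[ℝ] (Fin m → ℝ)) : Sig p q →ₗ[ℝ] Sig p q :=
  LinearMap.id - conj H ∘ₗ A

/-- The verifiable condition certifies `s`-goodness of `A`: for some `H` and some `γ < 1` one has
`Opt̄[Id - H^* A] ≤ γ`. -/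
def Certifies (A : Sig p q →ₗ[ℝ] (Fin m → ℝ)) (s : ℕ) : Prop :=
  ∃ (H : Sig p q →ₗ[ℝ] (Fin m → ℝ)) (γ : ℝ), γ < 1 ∧ optBar s (residual A H) ≤ γ

end NuclearRecovery

end

/-!
For `W = Id - H^* A` the matrix `Θ[W]` is a rearrangement of the entries of `W`, so both have the
same Frobenius norm. As `W` is the identity on `Ker A`, Bessel's inequality gives
`‖Θ[W]‖_F² ≥ d := dim Ker A` (`finrank_le_sum_norm_sq`, `finrank_ker_le_sum_sq_Theta`); in other
words, the squares of the `N = pq` singular values of `Θ[W]` sum up to at least `d`.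

Taking `𝒰 = 0` and for `𝒱` the partial isometry that sends the `2s` leading right singular vectors
of `Θ[W]` to the left ones shows that `Opt̄[W]` is at least the sum `S` of the `2s` largest singular
values (`exists_topSingular_isometry`, `sum_sigma_le_optBar`). For a nonincreasing nonnegative
sequence, the sum of `N` squares is at most `max (N / k²) 1 · S²`, where `S` is the sum of the first
`k` terms (`sum_sq_le_max_mul_sq`): the sum of squares is convex, so for given `S` it is bounded by
its values at a constant sequence and at a sequence with a single nonzero term. With `k = 2s` this
is the asserted lower bound.

If moreover `d ≥ c pq`, then `d ≥ 1`, and a value of `Opt̄` below `1` forces `2 s √c < 1`.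
-/

namespace NuclearRecovery

/-! ### Sums of leading terms of nonincreasing sequences -/

/-- With `τ = f (k - 1)` and `r = ∑ i < k, (f i - τ)`, the sum of squares is at most
`N τ² + 2 τ r + r²`, while the sum of the first `k` terms is `k τ + r`. -/
theorem sum_sq_le_max_mul_sq {f : ℕ → ℝ} (hf : Antitone f) (h0 : ∀ i, 0 ≤ f i) (N : ℕ) {k : ℕ}
    (hk : 0 < k) :
    ∑ i ∈ Finset.range N, f i ^ 2 ≤
      max ((N : ℝ) / (k : ℝ) ^ 2) 1 * (∑ i ∈ Finset.range k, f i) ^ 2 := by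
  set τ := f (k - 1) with hτ
  set r := ∑ i ∈ Finset.range k, (f i - τ) with hr
  have hk' : (0 : ℝ) < k := by exact_mod_cast hk
  have hτ0 : 0 ≤ τ := h0 _
  have hg : ∀ i ∈ Finset.range k, 0 ≤ f i - τ := fun i hi =>
    sub_nonneg.2 (hf (by have := Finset.mem_range.1 hi; omega))
  have hr0 : 0 ≤ r := Finset.sum_nonneg hg
  have hS : ∑ i ∈ Finset.range k, f i = k * τ + r := by
    simp [hr, Finset.sum_sub_distrib]
  -- For `i < k` one has `0 ≤ f i - τ ≤ r`, whereas `f i ≤ τ` for `i ≥ k`.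
  have hexc : ∀ i, f i ^ 2 ≤
      τ ^ 2 + (if i < k then 2 * τ * (f i - τ) + r * (f i - τ) else 0) := by
    intro i
    split_ifs with hi
    · have h1 : f i - τ ≤ r := Finset.single_le_sum hg (Finset.mem_range.2 hi)
      have h2 := hg i (Finset.mem_range.2 hi)
      nlinarith [mul_le_mul_of_nonneg_right h1 h2]
    · have : f i ≤ τ := hf (by omega)
      nlinarith [h0 i]
  have hexc0 : ∀ i ∈ Finset.range k, 0 ≤ 2 * τ * (f i - τ) + r * (f i - τ) := fun i hi => by
    have := hg i hi
    positivity
  have hsum : ∑ i ∈ Finset.range N, f i ^ 2 ≤ N * τ ^ 2 + (2 * τ * r + r * r) := by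
    refine (Finset.sum_le_sum fun i _ => hexc i).trans ?_
    rw [Finset.sum_add_distrib, ← Finset.sum_filter]
    simp only [Finset.sum_const, Finset.card_range, nsmul_eq_mul, add_le_add_iff_left]
    calc _ ≤ ∑ i ∈ Finset.range k, (2 * τ * (f i - τ) + r * (f i - τ)) := by
          refine Finset.sum_le_sum_of_subset_of_nonneg ?_ fun i hi _ => hexc0 i hi
          intro i hi
          exact Finset.mem_range.2 (Finset.mem_filter.1 hi).2
      _ = 2 * τ * r + r * r := by
          rw [Finset.sum_add_distrib, ← Finset.mul_sum, ← Finset.mul_sum]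
  rw [hS]
  refine hsum.trans ?_
  set M := max ((N : ℝ) / (k : ℝ) ^ 2) 1
  have hM1 : 1 ≤ M := le_max_right _ _
  have hMN : (N : ℝ) ≤ M * (k : ℝ) ^ 2 := (div_le_iff₀ (by positivity)).1 (le_max_left _ _)
  have hk1 : (1 : ℝ) ≤ k := by exact_mod_cast hk
  have hMk : 1 ≤ M * k := by nlinarith
  have e1 := mul_le_mul_of_nonneg_right hMN (sq_nonneg τ)
  have e2 := mul_le_mul_of_nonneg_right hMk (mul_nonneg hτ0 hr0)
  have e3 := mul_le_mul_of_nonneg_right hM1 (sq_nonneg r)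
  nlinarith

theorem min_le_sum_of_le_sum_sq {f : ℕ → ℝ} (hf : Antitone f) (h0 : ∀ i, 0 ≤ f i) {N : ℕ}
    (hN : 0 < N) (k : ℕ) {d : ℝ} (hd : d ≤ ∑ i ∈ Finset.range N, f i ^ 2) :
    min (k * √(d / N)) √d ≤ ∑ i ∈ Finset.range k, f i := by
  have hS0 : 0 ≤ ∑ i ∈ Finset.range k, f i := Finset.sum_nonneg fun i _ => h0 i
  rcases Nat.eq_zero_or_pos k with rfl | hk
  · simp
  have hk' : (0 : ℝ) < k := by exact_mod_cast hk
  have hN' : (0 : ℝ) < N := by exact_mod_cast hN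
  have h := hd.trans (sum_sq_le_max_mul_sq hf h0 N hk)
  rcases max_choice ((N : ℝ) / (k : ℝ) ^ 2) 1 with hM | hM <;> rw [hM] at h
  · refine (min_le_left _ _).trans ?_
    rw [← le_div_iff₀' hk']
    refine Real.sqrt_le_iff.2 ⟨by positivity, ?_⟩
    rw [div_le_iff₀ hN', div_pow]
    exact h.trans_eq (by ring)
  · exact (min_le_right _ _).trans (Real.sqrt_le_iff.2 ⟨hS0, by rwa [one_mul] at h⟩)

/-! ### Hilbert–Schmidt sums and singular values -/

section LinearMaps

variable {E F ι κ : Type*} [NormedAddCommGroup E] [InnerProductSpace ℝ E] [FiniteDimensional ℝ E]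
  [NormedAddCommGroup F] [InnerProductSpace ℝ F] [FiniteDimensional ℝ F] [Fintype ι] [Fintype κ]

theorem sum_inner_eq_trace (T V : E →ₗ[ℝ] F) (b : OrthonormalBasis ι ℝ E) :
    ∑ i, inner ℝ (T (b i)) (V (b i)) = LinearMap.trace ℝ E (LinearMap.adjoint T ∘ₗ V) := by
  rw [LinearMap.trace_eq_sum_inner _ b]
  exact Finset.sum_congr rfl fun i _ => by
    rw [LinearMap.comp_apply, LinearMap.adjoint_inner_right]

theorem sum_norm_sq_adjoint (T : E →ₗ[ℝ] F) (b : OrthonormalBasis ι ℝ E)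
    (c : OrthonormalBasis κ ℝ F) :
    ∑ j, ‖LinearMap.adjoint T (c j)‖ ^ 2 = ∑ i, ‖T (b i)‖ ^ 2 := by
  simp only [← real_inner_self_eq_norm_sq]
  rw [sum_inner_eq_trace, sum_inner_eq_trace, LinearMap.adjoint_adjoint,
    LinearMap.trace_comp_comm']

/-- An endomorphism that fixes a subspace pointwise has squared Hilbert–Schmidt norm at least the
dimension of the subspace. -/
theorem finrank_le_sum_norm_sq (T : E →ₗ[ℝ] E) (S : Submodule ℝ E) (hS : ∀ x ∈ S, T x = x)
    (b : OrthonormalBasis ι ℝ E) : (Module.finrank ℝ S : ℝ) ≤ ∑ i, ‖T (b i)‖ ^ 2 := by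
  let u := stdOrthonormalBasis ℝ S
  have hu : Orthonormal ℝ fun k => (u k : E) := u.orthonormal.comp_linearIsometry S.subtypeₗᵢ
  calc (Module.finrank ℝ S : ℝ)
      = ∑ k, ∑ i, ‖inner ℝ (u k : E) (LinearMap.adjoint T (b i))‖ ^ 2 := by
        have h1 : ∀ k, ∑ i, ‖inner ℝ (u k : E) (LinearMap.adjoint T (b i))‖ ^ 2 = 1 := fun k => by
          simp only [LinearMap.adjoint_inner_right, hS _ (u k).2]
          rw [b.sum_sq_norm_inner_left, hu.1 k, one_pow]
        rw [Finset.sum_congr rfl fun k _ => h1 k]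
        simp
    _ = ∑ i, ∑ k, ‖inner ℝ (u k : E) (LinearMap.adjoint T (b i))‖ ^ 2 := Finset.sum_comm
    _ ≤ ∑ i, ‖LinearMap.adjoint T (b i)‖ ^ 2 :=
        Finset.sum_le_sum fun i _ => hu.sum_inner_products_le _
    _ = _ := sum_norm_sq_adjoint T b b

/-- The right singular vectors of `T`: an orthonormal basis that `T` maps to pairwise orthogonal
vectors whose norms are the singular values. -/
theorem exists_singular_basis (T : E →ₗ[ℝ] F) {n : ℕ} (hn : Module.finrank ℝ E = n) :
    ∃ b : OrthonormalBasis (Fin n) ℝ E, ∀ i j,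
      inner ℝ (T (b i)) (T (b j)) = if i = j then T.singularValues i ^ 2 else 0 := by
  have hS := T.isSymmetric_adjoint_comp_self
  refine ⟨hS.eigenvectorBasis hn, fun i j => ?_⟩
  rw [← LinearMap.adjoint_inner_right, ← LinearMap.comp_apply, hS.apply_eigenvectorBasis,
    inner_smul_right, OrthonormalBasis.inner_eq_ite]
  split_ifs with h
  · subst h
    rw [T.sq_singularValues_fin hn]
    simp
  · simp

theorem sum_sq_singularValues (T : E →ₗ[ℝ] F) {n : ℕ} (hn : Module.finrank ℝ E = n)
    (b : OrthonormalBasis ι ℝ E) :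
    ∑ i ∈ Finset.range n, T.singularValues i ^ 2 = ∑ i, ‖T (b i)‖ ^ 2 := by
  obtain ⟨v, hv⟩ := exists_singular_basis T hn
  simp only [← real_inner_self_eq_norm_sq]
  rw [sum_inner_eq_trace, ← sum_inner_eq_trace T T v, Finset.sum_range]
  exact Finset.sum_congr rfl fun i _ => by rw [hv, if_pos rfl]

/-- The partial isometry sending the `k` leading right singular vectors of `T` to the left ones has
rank at most `k`, is a contraction, and pairs with `T` to the sum of the `k` largest singular
values. -/
theorem exists_topSingular_isometry (T : E →ₗ[ℝ] F) (k : ℕ) :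
    ∃ V : E →ₗ[ℝ] F, (∀ x, ‖V x‖ ≤ ‖x‖) ∧ Module.finrank ℝ (LinearMap.range V) ≤ k ∧
      LinearMap.trace ℝ E (LinearMap.adjoint T ∘ₗ V) =
        ∑ i ∈ Finset.range k, T.singularValues i := by
  obtain ⟨n, hn⟩ : ∃ n, Module.finrank ℝ E = n := ⟨_, rfl⟩
  obtain ⟨b, hb⟩ := exists_singular_basis T hn
  -- A vanishing singular value contributes `0⁻¹ • 0 = 0`.
  let w : Fin n → F := fun i => if (i : ℕ) < k then (T.singularValues i)⁻¹ • T (b i) else 0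
  have hw : ∀ i j, i ≠ j → inner ℝ (w i) (w j) = 0 := by
    intro i j hij
    simp only [w]
    split_ifs <;> simp [inner_smul_left, inner_smul_right, hb, hij]
  have hw1 : ∀ i, inner ℝ (w i) (w i) ≤ (1 : ℝ) := by
    intro i
    simp only [w]
    split_ifs
    · rw [real_inner_smul_left, real_inner_smul_right, hb, if_pos rfl]
      by_cases h : T.singularValues i = 0
      · simp [h]
      · exact le_of_eq (by field_simp)
    · simp
  have hV : ∀ x, b.toBasis.constr ℝ w x = ∑ i, inner ℝ (b i) x • w i := fun x => by
    simp [Module.Basis.constr_apply_fintype, OrthonormalBasis.repr_apply_apply]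
  refine ⟨b.toBasis.constr ℝ w, fun x => ?_, ?_, ?_⟩
  · refine le_of_sq_le_sq ?_ (norm_nonneg _)
    rw [← b.sum_sq_norm_inner_right x, ← real_inner_self_eq_norm_sq, hV, sum_inner]
    refine Finset.sum_le_sum fun i _ => ?_
    rw [inner_sum, Finset.sum_eq_single i]
    · rw [real_inner_smul_left, real_inner_smul_right, Real.norm_eq_abs, sq_abs]
      nlinarith [mul_le_mul_of_nonneg_left (hw1 i) (sq_nonneg (inner ℝ (b i) x))]
    · intro j _ hj
      rw [real_inner_smul_left, real_inner_smul_right, hw i j hj.symm]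
      simp
    · simp
  · classical
    let t : Finset (Fin n) := {i | (i : ℕ) < k}
    have hle : LinearMap.range (b.toBasis.constr ℝ w) ≤ Submodule.span ℝ (t.image w : Set F) := by
      rintro _ ⟨x, rfl⟩
      rw [hV]
      refine Submodule.sum_mem _ fun i _ => Submodule.smul_mem _ _ ?_
      by_cases hi : (i : ℕ) < k
      · exact Submodule.subset_span (Finset.mem_coe.2 (Finset.mem_image_of_mem w (by simp [t, hi])))
      · simp [w, hi]
    refine (Submodule.finrank_mono hle).trans ((finrank_span_finset_le_card _).trans ?_)
    refine Finset.card_image_le.trans ?_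
    rw [← Finset.card_range k, ← Finset.card_map Fin.valEmbedding]
    refine Finset.card_le_card fun i hi => ?_
    obtain ⟨j, hj, rfl⟩ := Finset.mem_map.1 hi
    exact Finset.mem_range.2 (Finset.mem_filter.1 hj).2
  · rw [← sum_inner_eq_trace T _ b]
    have h1 : ∀ i : Fin n, inner ℝ (T (b i)) (b.toBasis.constr ℝ w (b i)) =
        if (i : ℕ) < k then T.singularValues i else 0 := by
      intro i
      rw [← b.coe_toBasis, Module.Basis.constr_basis, b.coe_toBasis]
      simp only [w]
      split_ifs
      · rw [real_inner_smul_right, hb, if_pos rfl]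
        by_cases h : T.singularValues i = 0
        · simp [h]
        · field_simp
      · simp
    rw [Finset.sum_congr rfl fun i _ => h1 i,
      ← Finset.sum_range fun i => if i < k then T.singularValues i else 0, ← Finset.sum_filter]
    refine Finset.sum_subset (fun i hi => ?_) fun i hi hi' => ?_
    · exact Finset.mem_range.2 (Finset.mem_filter.1 hi).2
    · refine T.singularValues_of_finrank_le (hn.trans_le ?_)
      by_contra! h
      exact hi' (Finset.mem_filter.2 ⟨Finset.mem_range.2 h, Finset.mem_range.1 hi⟩)

end LinearMaps

/-! ### The lower bound on the relaxation -/

section Matrices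

variable {m n : Type*} [Fintype m] [Fintype n] [DecidableEq n]

theorem sum_mul_eq_trace (M N : Matrix m n ℝ) :
    ∑ a, ∑ b, M a b * N a b =
      LinearMap.trace ℝ (EuclideanSpace ℝ n)
        (LinearMap.adjoint (Matrix.toEuclideanLin M) ∘ₗ Matrix.toEuclideanLin N) := by
  rw [← sum_inner_eq_trace _ _ (EuclideanSpace.basisFun n ℝ), Finset.sum_comm]
  refine Finset.sum_congr rfl fun b _ => ?_
  simp [Matrix.toLpLin_apply, PiLp.inner_apply, mul_comm]

theorem sum_sq_sigma (M : Matrix m n ℝ) :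
    ∑ i ∈ Finset.range (Fintype.card n), sigma M i ^ 2 = ∑ a, ∑ b, M a b ^ 2 := by
  simp only [sigma, sq (M _ _)]
  rw [sum_sq_singularValues _ finrank_euclideanSpace (EuclideanSpace.basisFun n ℝ),
    sum_mul_eq_trace, ← sum_inner_eq_trace _ _ (EuclideanSpace.basisFun n ℝ)]
  simp only [real_inner_self_eq_norm_sq]

/-- A matrix of rank at most `k` and spectral norm at most `1` has at most `k` nonzero singular
values, each at most `1`. -/
theorem nuclearNorm_le_of_finrank_range_le {M : Matrix m n ℝ} {k : ℕ} (h1 : spectralNorm M ≤ 1)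
    (hk : Module.finrank ℝ (LinearMap.range (Matrix.toEuclideanLin M)) ≤ k) :
    nuclearNorm M ≤ k := by
  have hle : ∀ i, sigma M i ≤ if i < k then 1 else 0 := by
    intro i
    split_ifs with h
    · exact ((Matrix.toEuclideanLin M).singularValues_antitone (Nat.zero_le i)).trans h1
    · exact (LinearMap.singularValues_eq_zero_iff_le_finrank_range _).2
        (hk.trans (not_lt.1 h)) |>.le
  refine (Finset.sum_le_sum fun i _ => hle i).trans ?_
  rw [Finset.sum_boole]
  refine Nat.cast_le.2 ((Finset.card_le_card fun i hi => ?_).trans_eq (Finset.card_range k))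
  exact Finset.mem_range.2 (Finset.mem_filter.1 hi).2

end Matrices

variable {p q m : ℕ}

theorem sum_sigma_le_optBar (s : ℕ) (W : Sig p q →ₗ[ℝ] Sig p q) :
    ∑ i ∈ Finset.range (2 * s), sigma (Theta W) i ≤ optBar s W := by
  obtain ⟨V, hV1, hVk, hV⟩ := exists_topSingular_isometry (Matrix.toEuclideanLin (Theta W)) (2 * s)
  obtain ⟨V, rfl⟩ := Matrix.toEuclideanLin.surjective V
  have hsp := (spectralNorm_le_one_iff V).2 hV1
  refine (optBar_isGreatest s W).2
    ⟨0, zero_mem_relaxSet p q (Nat.cast_nonneg s), V, ⟨?_, hsp⟩, ?_⟩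
  · exact_mod_cast nuclearNorm_le_of_finrank_range_le hsp hVk
  · simp only [Matrix.zero_apply, zero_add]
    rw [sum_mul_eq_trace, hV]
    rfl

/-- `Sig p q` carries no inner product, so the bound is transported to the Euclidean space of the
entries. -/
theorem finrank_ker_le_sum_sq_Theta (A H : Sig p q →ₗ[ℝ] (Fin m → ℝ)) :
    (Module.finrank ℝ (LinearMap.ker A) : ℝ) ≤ ∑ a, ∑ b, Theta (residual A H) a b ^ 2 := by
  let φ : EuclideanSpace ℝ (Fin p × Fin q) ≃ₗ[ℝ] Sig p q :=
    (WithLp.linearEquiv 2 ℝ (Fin p × Fin q → ℝ)).trans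
      ((LinearEquiv.curry ℝ ℝ (Fin p) (Fin q)).trans (Matrix.ofLinearEquiv ℝ))
  let T : EuclideanSpace ℝ (Fin p × Fin q) →ₗ[ℝ] EuclideanSpace ℝ (Fin p × Fin q) :=
    φ.symm.toLinearMap ∘ₗ residual A H ∘ₗ φ.toLinearMap
  have h := finrank_le_sum_norm_sq T ((LinearMap.ker A).map φ.symm.toLinearMap) ?_
    (EuclideanSpace.basisFun (Fin p × Fin q) ℝ)
  · rw [LinearEquiv.finrank_map_eq φ.symm] at h
    refine h.trans_eq ?_
    have hφ : ∀ c : Fin p × Fin q,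
        φ (EuclideanSpace.single c 1) = Matrix.single c.1 c.2 1 := by
      rintro ⟨i, j⟩
      ext i' j'
      by_cases hi : i' = i <;> by_cases hj : j' = j <;>
        simp [φ, Matrix.single_apply, LinearEquiv.curry, hi, hj] <;> grind
    have hT : ∀ c x, T (EuclideanSpace.single c 1) x =
        residual A H (Matrix.single c.1 c.2 1) x.1 x.2 := by
      intro c x
      rw [← hφ]
      rfl
    simp only [EuclideanSpace.basisFun_apply, EuclideanSpace.norm_sq_eq, Real.norm_eq_abs, sq_abs,
      hT, Theta, Matrix.of_apply, Fintype.sum_prod_type]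
    symm
    rw [Finset.sum_comm]
    refine Finset.sum_congr rfl fun i _ => ?_
    rw [Finset.sum_comm]
    symm
    rw [Finset.sum_comm]
    exact Finset.sum_congr rfl fun ν _ => Finset.sum_comm
  · rintro _ ⟨z, hz, rfl⟩
    have hz' : A z = 0 := hz
    simp [T, residual, hz']

theorem min_le_optBar_residual (hp : 0 < p) (hq : 0 < q) (s : ℕ)
    (A H : Sig p q →ₗ[ℝ] (Fin m → ℝ)) :
    min (2 * (s : ℝ) * √((Module.finrank ℝ (LinearMap.ker A) : ℝ) / ((p : ℝ) * (q : ℝ))))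
        √(Module.finrank ℝ (LinearMap.ker A) : ℝ) ≤ optBar s (residual A H) := by
  refine le_trans ?_ (sum_sigma_le_optBar s (residual A H))
  have h := (finrank_ker_le_sum_sq_Theta A H).trans_eq (sum_sq_sigma _).symm
  have h2 := min_le_sum_of_le_sum_sq (LinearMap.singularValues_antitone _)
    (LinearMap.singularValues_nonneg _) (by simp [hp, hq]) (2 * s) h
  simp only [Fintype.card_prod, Fintype.card_fin, Nat.cast_mul, Nat.cast_ofNat] at h2
  exact h2

end NuclearRecovery

open NuclearRecovery in
theorem proposition6 :
    (∀ (p q m s : ℕ), 0 < q → q ≤ p →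
      ∀ A H : NuclearRecovery.Sig p q →ₗ[ℝ] (Fin m → ℝ),
        min (2 * (s : ℝ) * Real.sqrt
              ((Module.finrank ℝ (LinearMap.ker A) : ℝ) / ((p : ℝ) * (q : ℝ))))
            (Real.sqrt (Module.finrank ℝ (LinearMap.ker A) : ℝ))
          ≤ NuclearRecovery.optBar s (NuclearRecovery.residual A H)) ∧
    (∀ c : ℝ, 0 < c → ∃ C : ℝ, ∀ (p q m s : ℕ), 0 < q → q ≤ p →
      ∀ A : NuclearRecovery.Sig p q →ₗ[ℝ] (Fin m → ℝ),
        c * ((p : ℝ) * (q : ℝ)) ≤ (Module.finrank ℝ (LinearMap.ker A) : ℝ) →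
        NuclearRecovery.Certifies A s → (s : ℝ) ≤ C) := by
  refine ⟨fun p q m s hq hqp A H => min_le_optBar_residual (hq.trans_le hqp) hq s A H, ?_⟩
  intro c hc
  refine ⟨1 / (2 * √c), ?_⟩
  rintro p q m s hq hqp A hA ⟨H, γ, hγ, hopt⟩
  have hp := hq.trans_le hqp
  have hpq : (0 : ℝ) < (p : ℝ) * q := by positivity
  have h := ((min_le_optBar_residual hp hq s A H).trans hopt).trans_lt hγ
  -- `Ker A` is nontrivial, so that the second term of the minimum is at least `1`.
  have hd : (1 : ℝ) ≤ Module.finrank ℝ (LinearMap.ker A) := by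
    have : (0 : ℝ) < Module.finrank ℝ (LinearMap.ker A) := (mul_pos hc hpq).trans_le hA
    exact_mod_cast this
  have hmin := (min_lt_iff.1 h).resolve_right (not_lt.2 (Real.one_le_sqrt.2 hd))
  have hcd : √c ≤ √((Module.finrank ℝ (LinearMap.ker A) : ℝ) / ((p : ℝ) * (q : ℝ))) :=
    Real.sqrt_le_sqrt ((le_div_iff₀ hpq).2 hA)
  rw [le_div_iff₀ (by positivity)]
  nlinarith [mul_le_mul_of_nonneg_left hcd (by positivity : (0 : ℝ) ≤ 2 * s)]
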